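/- A seller offers a service over $[0,T]$ ($T>0$) to a buyer. The match quality $\theta\in\{L,H\}$ has prior $\Pr(\theta=H)=\mu_0\in(0,1)$ and is observed only by the seller. Independently, the reward size $v$ has a distribution $F$ with a density $f$ with support $[\underline v,\bar v]$, $\underline v\ge 0$, with $\mathbb E[v]=1$ and $v-(1-F(v))/f(v)$ increasing; it is not observed by the seller. If $\theta=H$, rewards arrive, observed only by the buyer, as a Poisson process of rate $\lambda I_t$ ($\lambda>0$), where $I_t\in[0,1]$ is the access granted at $t$; if $\theta=L$, none arrive. Each reward is worth $v$, and the first one reveals $\theta=H$ and $v$ to the buyer. Assume $\lambda T\ge 2(\mu_0-\underline v)/((1-\mu_0)\underline v)$. A (deterministic, direct) mechanism asks the seller for $\theta$ at time $0$ and lets the buyer report, at one time $s>0$, that a first reward of size $v\in[\underline v,\bar v]$ has arrived. It prescribes measurable access $I_t\in[0,1]$ and cumulative price $p_t\in\mathbb R$ as functions of the seller's report and of the buyer's messages before $t$. The buyer may quit at any time $t$ after paying $p_t$. If the buyer has received $N$ rewards and paid $p$ in total, the buyer's payoff is $Nv-p$ and the seller's is $p$. A strategy of the buyer is a measurable non-anticipating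 rule for reporting and quitting, based on the past arrivals, on $v$ once a reward has arrived, and on past access and prices. The mechanism is IC-IR if (i) each type of the seller maximizes expected payoff by reporting $\theta$ truthfully to a truthful buyer; (ii) reporting the first reward truthfully at its arrival and never quitting maximizes the buyer's ex-ante expected payoff over all strategies, when the seller is truthful; and (iii) under truth-telling both types of the seller and the buyer have nonnegative expected payoffs. Let $\Pi_{\text{IC-IR}}\subset\mathbb R^2$ be the set of pairs $(\pi_L,\pi_H)$ of expected payoffs of the two seller types under truth-telling in IC-IR mechanisms. Then selling ex ante (full access at all times and after all reports, for the constant price $\lambda\mu_0T$ paid at time $0$) is an IC-IR mechanism with payoffs $(\lambda\mu_0T,\lambda\mu_0T)$; this pair is the unique maximizer of $(1-\mu_0)\pi_L+\mu_0\pi_H$ over $(\pi_L,\pi_H)\in\Pi_{\text{IC-IR}}$; and $$\max_{(\pi_L,\pi_H)\in\Pi_{\text{IC-IR}}}\big[(1-\mu_0)\pi_L+\mu_0\pi_H\big]=\lambda\mu_0T .$$ -/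

import Mathlib

open MeasureTheory ProbabilityTheory Set

noncomputable section

namespace InformedSeller

/-- The match quality `θ` of the service; it is also the private type of the seller. -/
inductive Quality
  | low
  | high

/-- The primitives of the model and its standing assumptions. -/
structure Env where
  /-- flow rate of rewards at full access when the quality is high -/
  lam : ℝ
  /-- length of the service -/
  T : ℝ
  /-- prior probability of high quality -/
  mu0 : ℝ
  /-- lowest reward size -/
  vLo : ℝ
  /-- highest reward size -/
  vHi : ℝ
  /-- density of the prior on the reward size -/
  f : ℝ → ℝ
  lam_pos : 0 < lam
  T_pos : 0 < T
  mu0_mem : mu0 ∈ Ioo (0 : ℝ) 1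
  vLo_nonneg : 0 ≤ vLo
  f_measurable : Measurable f
  f_nonneg : ∀ v, 0 ≤ f v
  f_support : tsupport f = Icc vLo vHi
  f_integral : ∫ v, f v = 1
  /-- the normalization `𝔼[v] = 1` -/
  f_mean : ∫ v, v * f v = 1
  /-- Myerson regularity: the virtual value `v - (1 - F(v)) / f(v)` is increasing -/
  regular : MonotoneOn (fun v => v - (1 - ∫ x in Iic v, f x) / f v)
    {v | v ∈ Icc vLo vHi ∧ 0 < f v}
  /-- `λ T ≥ 2 (μ₀ - v̲) / ((1 - μ₀) v̲)`, without the division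
  (so that it fails, as it should, for `v̲ = 0`) -/
  long_horizon : 2 * (mu0 - vLo) ≤ lam * T * ((1 - mu0) * vLo)

namespace Env

/-- The prior on the reward size. -/
def F (E : Env) : Measure ℝ := volume.withDensity fun v => ENNReal.ofReal (E.f v)

/-- The law of the chance moves other than `θ`: the reward size `v`, with law `F`, and,
independently, an i.i.d. sequence of standard exponential gaps, the gaps between the points of a
Poisson process of rate one. -/
def law (E : Env) : Measure (ℝ × (ℕ → ℝ)) :=
  E.F.prod (Measure.infinitePi fun _ : ℕ => expMeasure 1)

end Env

/-- The `k`-th point (`k = 0, 1, …`) of the rate-one Poisson process with gaps `e`. -/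
def point (e : ℕ → ℝ) (k : ℕ) : ℝ := ∑ i ∈ Finset.range (k + 1), e i

/-- The possible chance moves; almost every pair `(v, e)` is one. -/
def IsState (E : Env) (ω : ℝ × (ℕ → ℝ)) : Prop :=
  ω.1 ∈ Icc E.vLo E.vHi ∧ (∀ k, 0 < ω.2 k) ∧
    Filter.Tendsto (point ω.2) Filter.atTop Filter.atTop

/-- A deterministic direct mechanism. The first argument of each function is the report of the
seller. `IU q t`, `pU q t` are the access and the cumulative price at time `t` if the buyer
has sent only the message "no reward yet" before `t`; `IR q v s t`, `pR q v s t` are those at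
time `t` if the buyer has reported a first reward of size `v` at time `s`, where `0 < s < t`. -/
structure Mechanism (E : Env) where
  IU : Quality → ℝ → ℝ
  IR : Quality → ℝ → ℝ → ℝ → ℝ
  pU : Quality → ℝ → ℝ
  pR : Quality → ℝ → ℝ → ℝ → ℝ
  IU_mem : ∀ q, ∀ t ∈ Icc 0 E.T, IU q t ∈ Icc (0 : ℝ) 1
  IR_mem : ∀ q, ∀ v ∈ Icc E.vLo E.vHi, ∀ s t, 0 < s → s < t → t ≤ E.T →
    IR q v s t ∈ Icc (0 : ℝ) 1
  IU_measurable : ∀ q, Measurable (IU q)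
  IR_measurable : ∀ q, Measurable fun x : ℝ × ℝ × ℝ => IR q x.1 x.2.1 x.2.2
  pU_measurable : ∀ q, Measurable (pU q)
  pR_measurable : ∀ q, Measurable fun x : ℝ × ℝ × ℝ => pR q x.1 x.2.1 x.2.2

/-- What a buyer does in one realization of the game: report the first reward at time
`reportTime`, with size `reportValue`, and quit at time `exitTime`. Since a message affects the
mechanism only at later times, `reportTime = T` amounts to never reporting; `exitTime = T` is
staying to the end. -/
structure Conduct where
  reportTime : ℝ
  reportValue : ℝ
  exitTime : ℝ

namespace Mechanism

variable {E : Env} (M : Mechanism E)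

/-- Access at time `t` after the seller's report `q`. -/
def access (q : Quality) (c : Conduct) (t : ℝ) : ℝ :=
  open Classical in
  if c.reportTime < t then M.IR q c.reportValue c.reportTime t else M.IU q t

/-- Cumulative price at time `t` after the seller's report `q`. -/
def price (q : Quality) (c : Conduct) (t : ℝ) : ℝ :=
  open Classical in
  if c.reportTime < t then M.pR q c.reportValue c.reportTime t else M.pU q t

/-- Number `N_t` of rewards up to time `t`, for true quality `θ` and report `q` of the seller.
If `θ` is high, rewards arrive at rate `λ` times the access: they are the points of the rate-one
Poisson process run on the clock `t ↦ λ ∫₀ᵗ I_s ds`. If `θ` is low, there are none. -/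
def count (θ q : Quality) (c : Conduct) (e : ℕ → ℝ) (t : ℝ) : ℕ :=
  match θ with
  | .low => 0
  | .high => {k : ℕ | point e k ≤ E.lam * ∫ s in (0 : ℝ)..t, M.access q c s}.ncard

/-- The truthful buyer reports the first reward at the moment of its arrival, with its true size,
and never quits. -/
def truthful (θ q : Quality) (ω : ℝ × (ℕ → ℝ)) : Conduct where
  reportTime :=
    sInf ({t | t ∈ Icc 0 E.T ∧ 0 < M.count θ q ⟨E.T, ω.1, E.T⟩ ω.2 t} ∪ {E.T})
  reportValue := ω.1
  exitTime := E.T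

/-- Two realizations (with the seller reporting truthfully) look the same to the buyer at time
`t`: the same arrivals up to `t`, the same reward size if there was an arrival, and the same
access and prices before `t`. -/
def SameObservations (θ θ' : Quality) (ω ω' : ℝ × (ℕ → ℝ)) (c c' : Conduct) (t : ℝ) : Prop :=
  (∀ s ∈ Icc 0 t, M.count θ θ c ω.2 s = M.count θ' θ' c' ω'.2 s) ∧
  (0 < M.count θ θ c ω.2 t → ω.1 = ω'.1) ∧
  ∀ s ∈ Ico 0 t, M.access θ c s = M.access θ' c' s ∧ M.price θ c s = M.price θ' c' s

/-- A (pure) strategy of the buyer in the mechanism, described by the conduct to which it leads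
in every realization when the seller reports truthfully. No message other than "no reward yet"
is possible at time `0`. The decisions at time `t` depend only on what the
buyer has observed by then. -/
structure BuyerStrategy where
  conduct : Quality → ℝ × (ℕ → ℝ) → Conduct
  reportTime_measurable : ∀ θ, Measurable fun ω => (conduct θ ω).reportTime
  reportValue_measurable : ∀ θ, Measurable fun ω => (conduct θ ω).reportValue
  exitTime_measurable : ∀ θ, Measurable fun ω => (conduct θ ω).exitTime
  reportTime_mem : ∀ θ ω, IsState E ω → (conduct θ ω).reportTime ∈ Ioc 0 E.T
  reportValue_mem : ∀ θ ω, IsState E ω → (conduct θ ω).reportValue ∈ Icc E.vLo E.vHi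
  exitTime_mem : ∀ θ ω, IsState E ω → (conduct θ ω).exitTime ∈ Icc 0 E.T
  nonanticipating : ∀ θ θ' ω ω', IsState E ω → IsState E ω' → ∀ t ∈ Icc 0 E.T,
    M.SameObservations θ θ' ω ω' (conduct θ ω) (conduct θ' ω') t →
      ((conduct θ ω).reportTime = t ↔ (conduct θ' ω').reportTime = t) ∧
      ((conduct θ ω).reportTime = t → t < E.T →
        (conduct θ ω).reportValue = (conduct θ' ω').reportValue) ∧
      ((conduct θ ω).exitTime = t ↔ (conduct θ' ω').exitTime = t)

end Mechanism

/-- Expectation with values in the extended reals: the expectation of the positive part minus that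
of the negative part (`-∞` if both are infinite). -/
def expectation {Ω : Type*} [MeasurableSpace Ω] (P : Measure Ω) (g : Ω → ℝ) : EReal :=
  ((∫⁻ ω, ENNReal.ofReal (g ω) ∂P : ENNReal) : EReal) -
    ((∫⁻ ω, ENNReal.ofReal (-(g ω)) ∂P : ENNReal) : EReal)

namespace Mechanism

variable {E : Env} (M : Mechanism E)

/-- Expected payoff of the seller of type `θ` who reports `q` to a truthful buyer. -/
def sellerPayoff (θ q : Quality) : EReal :=
  expectation E.law fun ω => M.price q (M.truthful θ q ω) E.T

/-- Expected payoff `𝔼[N v - p | θ]` of the buyer when the seller is truthful, given `θ`. -/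
def buyerPayoffGiven (θ : Quality) (c : ℝ × (ℕ → ℝ) → Conduct) : EReal :=
  expectation E.law fun ω =>
    (M.count θ θ (c ω) ω.2 (c ω).exitTime : ℝ) * ω.1 - M.price θ (c ω) (c ω).exitTime

/-- Ex-ante expected payoff of the buyer, under the prior `μ₀`, when the seller is truthful. -/
def buyerPayoff (c : Quality → ℝ × (ℕ → ℝ) → Conduct) : EReal :=
  (E.mu0 : EReal) * M.buyerPayoffGiven .high (c .high) +
    ((1 - E.mu0 : ℝ) : EReal) * M.buyerPayoffGiven .low (c .low)

/-- Incentive compatible (truth-telling is optimal for both types of the seller and for the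
buyer) and individually rational (nonnegative ex-ante payoffs). -/
structure IsICIR : Prop where
  seller_ic : ∀ θ q, M.sellerPayoff θ q ≤ M.sellerPayoff θ θ
  buyer_ic : ∀ σ : M.BuyerStrategy,
    M.buyerPayoff σ.conduct ≤ M.buyerPayoff fun θ ω => M.truthful θ θ ω
  seller_ir : ∀ θ, 0 ≤ M.sellerPayoff θ θ
  buyer_ir : 0 ≤ M.buyerPayoff fun θ ω => M.truthful θ θ ω

end Mechanism

/-- The set of pairs `(π_L, π_H)` of (finite) seller payoffs from IC-IR mechanisms. -/
def payoffSet (E : Env) : Set (ℝ × ℝ) :=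
  {π | ∃ M : Mechanism E, M.IsICIR ∧
    M.sellerPayoff .low .low = (π.1 : EReal) ∧ M.sellerPayoff .high .high = (π.2 : EReal)}

/-- Selling ex ante: full access throughout, at the price `λ μ₀ T`, paid at time `0`. -/
def sellExAnte (E : Env) : Mechanism E where
  IU _ _ := 1
  IR _ _ _ _ := 1
  pU _ _ := E.lam * E.mu0 * E.T
  pR _ _ _ _ := E.lam * E.mu0 * E.T
  IU_mem _ _ _ := by simp
  IR_mem _ _ _ _ _ _ _ _ := by simp
  IU_measurable _ := measurable_const
  IR_measurable _ := measurable_const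
  pU_measurable _ := measurable_const
  pR_measurable _ := measurable_const

/-- Prior-weighted seller payoff `(1 - μ₀) π_L + μ₀ π_H`. -/
def weightedPayoff (E : Env) (π : ℝ × ℝ) : ℝ := (1 - E.mu0) * π.1 + E.mu0 * π.2

end InformedSeller

end

/-!
The expected number of rewards under full access is `λ T` when the quality is high, and a reward is
worth `𝔼[v] = 1`, so the surplus is at most `λ μ₀ T`. The buyer's participation constraint
therefore bounds the weighted payoff of the seller by `λ μ₀ T` (`Mechanism.weightedPayoff_le`), and
selling ex ante attains the bound (`isICIR_sellExAnte`). That the mean number of rewards is `λ T`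
follows from the Erlang densities of the points of a Poisson process, which sum to one on `[0, ∞)`
(`tsum_gapLaw_point_le`).

The uniqueness of the maximizer combines the incentive constraints of the two sides. Suppose that
the weighted payoff is `λ μ₀ T`. Then the buyer's truthful payoff is zero, and access is almost
surely full when the quality is high and the buyer is truthful (`Mechanism.ae_finalClock_eq`).
Fix a quality `τ`. The buyer may ignore the actual rewards, draw a fictitious realization, and
report as a truthful buyer facing quality `τ` would do in it (`Mechanism.simulate`). To do so he
need not know the report of the seller: the fictitious arrival time depends only on the access
granted before it. If the true quality is high, access is full, so he gets the whole surplus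
`λ μ₀ T` in expectation. As the deviation yields at most zero, his expected price
`μ₀ S(τ, H) + (1 - μ₀) S(τ, L)` is at least `λ μ₀ T`, where `S(τ, q)` is the payoff of seller type
`τ` from the report `q`. Incentive compatibility for the seller gives `S(τ, q) ≤ S(τ, τ)`, hence
`S(τ, τ) ≥ λ μ₀ T` (`Mechanism.le_sellerPayoff`). Both types get at least `λ μ₀ T` and the average
is `λ μ₀ T`, so both get exactly that.

Strategies of the buyer are pure, so the deviation is applied for each fixed fictitious realization,
and the resulting inequalities are integrated over the law of the chance moves.
-/

noncomputable section

namespace InformedSeller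

/-! ### The points of the rate-one Poisson process -/

/-- The law of the i.i.d. standard exponential gaps. -/
def gapLaw : Measure (ℕ → ℝ) := Measure.infinitePi fun _ : ℕ => expMeasure 1

instance : IsProbabilityMeasure (expMeasure 1) := isProbabilityMeasure_expMeasure one_pos

instance : IsProbabilityMeasure gapLaw := by unfold gapLaw; infer_instance

/-- Density of the Erlang distribution of the point number `k` (counted from `0`). -/
def erlang (k : ℕ) (x : ℝ) : ENNReal :=
  (Ici (0 : ℝ)).indicator (fun x => ENNReal.ofReal (Real.exp (-x) * (x ^ k / k.factorial))) x

@[fun_prop]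
lemma measurable_erlang (k : ℕ) : Measurable (erlang k) := by
  unfold erlang
  exact Measurable.indicator (by fun_prop) measurableSet_Ici

lemma expMeasure_one_eq : expMeasure 1 = volume.withDensity (erlang 0) := by
  rw [expMeasure, gammaMeasure]
  congr 1
  ext x
  change exponentialPDF 1 x = _
  rw [exponentialPDF_eq]
  by_cases hx : 0 ≤ x <;> simp [erlang, hx]

lemma lconvolution_erlang (k : ℕ) : erlang k ⋆ₗ erlang 0 = erlang (k + 1) := by
  ext x
  rw [lconvolution_def]
  -- The exponential factors multiply to one that does not depend on `y`.
  have key : ∀ y, erlang k y * erlang 0 (-y + x) =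
      (Icc 0 x).indicator
        (fun y => ENNReal.ofReal (Real.exp (-x) * (y ^ k / k.factorial))) y := by
    intro y
    by_cases hy : 0 ≤ y
    · by_cases hyx : y ≤ x
      · have h1 : 0 ≤ -y + x := by linarith
        simp only [erlang, mem_Ici, hy, indicator_of_mem, h1, mem_Icc, hyx, and_self]
        rw [← ENNReal.ofReal_mul (by positivity)]
        congr 1
        have : Real.exp (-x) = Real.exp (-y) * Real.exp (-(-y + x)) := by
          rw [← Real.exp_add]; ring_nf
        rw [this]; simp; ring
      · have h1 : ¬ 0 ≤ -y + x := by linarith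
        simp [erlang, h1, hyx]
    · simp [erlang, hy]
  simp_rw [key]
  rw [lintegral_indicator measurableSet_Icc]
  by_cases hx : 0 ≤ x
  · rw [← ofReal_integral_eq_lintegral_ofReal]
    · rw [integral_Icc_eq_integral_Ioc, ← intervalIntegral.integral_of_le hx]
      simp only [erlang, mem_Ici, hx, indicator_of_mem]
      rw [intervalIntegral.integral_const_mul, intervalIntegral.integral_div, integral_pow]
      congr 2
      rw [Nat.factorial_succ]; push_cast
      have : (k.factorial : ℝ) ≠ 0 := by positivity
      field_simp
      simp
    · exact (Continuous.integrableOn_Icc (by fun_prop))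
    · filter_upwards [ae_restrict_mem measurableSet_Icc] with y hy
      have := hy.1
      simp only [Pi.zero_apply]; positivity
  · simp [erlang, hx]

lemma measurable_point (k : ℕ) : Measurable fun e => point e k := by
  unfold point; fun_prop

lemma point_succ (e : ℕ → ℝ) (k : ℕ) : point e (k + 1) = point e k + e (k + 1) :=
  Finset.sum_range_succ _ _

lemma point_zero (e : ℕ → ℝ) : point e 0 = e 0 := by simp [point]

lemma map_eval_gapLaw (k : ℕ) : gapLaw.map (fun e => e k) = expMeasure 1 :=
  Measure.infinitePi_map_eval (fun _ : ℕ => expMeasure 1) k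

lemma map_point_gapLaw (k : ℕ) :
    gapLaw.map (fun e => point e k) = volume.withDensity (erlang k) := by
  induction k with
  | zero => simp_rw [point_zero, map_eval_gapLaw, expMeasure_one_eq]
  | succ k ih =>
    have hind : iIndepFun (fun (i : ℕ) (e : ℕ → ℝ) => e i) gapLaw :=
      iIndepFun_infinitePi (P := fun _ : ℕ => expMeasure 1) (X := fun _ x => x)
        (fun _ => measurable_id)
    have h2 : IndepFun (fun e => point e k) (fun e : ℕ → ℝ => e (k + 1)) gapLaw := by
      have := hind.indepFun_finsetSum_of_notMem (fun i => measurable_pi_apply i)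
        (s := Finset.range (k + 1)) (i := k + 1) (by simp)
      convert this using 1
      ext e; simp [point]
    have h3 := h2.map_add_eq_map_conv_map (measurable_point k) (measurable_pi_apply _)
    rw [ih, map_eval_gapLaw, expMeasure_one_eq,
      conv_withDensity_eq_lconvolution (measurable_erlang _) (measurable_erlang _),
      lconvolution_erlang] at h3
    rw [← h3]
    congr 1
    ext e; simp [point_succ]

lemma tsum_erlang (x : ℝ) : ∑' k, erlang k x = (Ici (0 : ℝ)).indicator 1 x := by
  by_cases hx : 0 ≤ x
  · simp only [erlang, mem_Ici, hx, indicator_of_mem]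
    have hs := NormedSpace.expSeries_div_hasSum_exp (x : ℝ)
    rw [← Real.exp_eq_exp_ℝ] at hs
    have hs' := hs.mul_left (Real.exp (-x))
    rw [← ENNReal.ofReal_tsum_of_nonneg (fun n => by positivity) hs'.summable, hs'.tsum_eq,
      ← Real.exp_add]
    simp
  · simp [erlang, hx]

/-- A rate-one Poisson process has on average `a` points in `[0, a]`: the Erlang densities
sum to one. -/
lemma tsum_gapLaw_point_le (a : ℝ) :
    ∑' k, gapLaw {e | point e k ≤ a} = ENNReal.ofReal a := by
  have h : ∀ k, gapLaw {e | point e k ≤ a} = ∫⁻ x in Iic a, erlang k x := by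
    intro k
    rw [← withDensity_apply _ measurableSet_Iic, ← map_point_gapLaw,
      Measure.map_apply (measurable_point k) measurableSet_Iic]
    rfl
  simp_rw [h]
  rw [← lintegral_tsum (fun k => (measurable_erlang k).aemeasurable)]
  simp_rw [tsum_erlang]
  rw [lintegral_indicator_one measurableSet_Ici, Measure.restrict_apply measurableSet_Ici]
  rw [Ici_inter_Iic, Real.volume_Icc, sub_zero]

/-- Number of points up to time `a`, as an extended number. -/
def numPoints (e : ℕ → ℝ) (a : ℝ) : ENNReal := ∑' k, if point e k ≤ a then 1 else 0

/-- If there are infinitely many points up to `a`, both sides are zero by convention. -/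
lemma ncard_point_le (e : ℕ → ℝ) (a : ℝ) :
    ({k : ℕ | point e k ≤ a}.ncard : ℝ) = (numPoints e a).toReal := by
  have h : numPoints e a = ({k : ℕ | point e k ≤ a}.encard : ENNReal) := by
    rw [← ENNReal.tsum_set_one, tsum_subtype {k : ℕ | point e k ≤ a} (fun _ => (1 : ENNReal))]
    rfl
  rw [h, Set.ncard]
  rcases Set.finite_or_infinite {k : ℕ | point e k ≤ a} with hf | hf
  · rw [hf.encard_eq_coe]; simp
  · rw [hf.encard_eq]; simp

lemma measurable_numPoints : Measurable fun x : (ℕ → ℝ) × ℝ => numPoints x.1 x.2 := by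
  unfold numPoints
  refine Measurable.tsum fun k => Measurable.ite ?_ measurable_const measurable_const
  exact measurableSet_le ((measurable_point k).comp measurable_fst) measurable_snd

lemma lintegral_numPoints (a : ℝ) :
    ∫⁻ e, numPoints e a ∂gapLaw = ENNReal.ofReal a := by
  unfold numPoints
  have hm : ∀ k, MeasurableSet {e : ℕ → ℝ | point e k ≤ a} := fun k =>
    measurableSet_le (measurable_point k) measurable_const
  rw [lintegral_tsum (fun k => (Measurable.ite (hm k) measurable_const
    measurable_const).aemeasurable), ← tsum_gapLaw_point_le a]
  congr 1; ext k
  rw [← lintegral_indicator_one (hm k)]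
  rfl

lemma ae_gap_pos : ∀ᵐ e ∂gapLaw, ∀ k, 0 < e k := by
  rw [ae_all_iff]
  intro k
  have h : ∀ᵐ x ∂(expMeasure 1), 0 < x := by
    rw [expMeasure_one_eq, ae_withDensity_iff (measurable_erlang 0)]
    filter_upwards [Measure.ae_ne volume (0 : ℝ)] with x hx h
    by_contra hlt
    have : ¬ 0 ≤ x := fun h0 => hlt (lt_of_le_of_ne h0 (Ne.symm hx))
    exact h (by simp [erlang, this])
  rw [← map_eval_gapLaw k] at h
  exact ae_of_ae_map (measurable_pi_apply k).aemeasurable h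

/-- Almost surely there are finitely many points in every bounded interval. -/
lemma ae_tendsto_point : ∀ᵐ e ∂gapLaw, Filter.Tendsto (point e) Filter.atTop Filter.atTop := by
  have h : ∀ᵐ e ∂gapLaw, ∀ n : ℕ, {k | point e k ≤ n}.Finite := by
    rw [ae_all_iff]
    intro n
    exact ae_finite_setOfPred_mem (s := fun k => {e | point e k ≤ n})
      (by rw [tsum_gapLaw_point_le]; exact ENNReal.ofReal_ne_top)
  filter_upwards [h] with e he
  rw [← Nat.cofinite_eq_atTop, Filter.tendsto_atTop]
  intro b
  obtain ⟨n, hn⟩ := exists_nat_ge b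
  rw [Filter.eventually_cofinite]
  exact (he n).subset fun k hk => by
    simp only [not_le, mem_ofPred_eq] at hk ⊢
    linarith

/-! ### Expectations with values in the extended reals -/

section expectation

variable {Ω : Type*} [MeasurableSpace Ω] {P : Measure Ω}

lemma expectation_mono {g h : Ω → ℝ} (hgh : g ≤ᵐ[P] h) : expectation P g ≤ expectation P h := by
  unfold expectation
  refine EReal.sub_le_sub ?_ ?_
  · exact EReal.coe_ennreal_le_coe_ennreal_iff.2
      (lintegral_mono_ae (hgh.mono fun ω hω => ENNReal.ofReal_le_ofReal hω))
  · exact EReal.coe_ennreal_le_coe_ennreal_iff.2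
      (lintegral_mono_ae (hgh.mono fun ω hω => ENNReal.ofReal_le_ofReal (neg_le_neg hω)))

lemma expectation_congr {g h : Ω → ℝ} (hgh : g =ᵐ[P] h) : expectation P g = expectation P h :=
  le_antisymm (expectation_mono hgh.le) (expectation_mono hgh.symm.le)

lemma expectation_eq_integral {g : Ω → ℝ} (hg : Integrable g P) :
    expectation P g = ((∫ ω, g ω ∂P : ℝ) : EReal) := by
  unfold expectation
  rw [integral_eq_lintegral_pos_part_sub_lintegral_neg_part hg]
  have h1 : ∫⁻ ω, ENNReal.ofReal (g ω) ∂P ≠ ⊤ := hg.lintegral_lt_top.ne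
  have h2 : ∫⁻ ω, ENNReal.ofReal (-(g ω)) ∂P ≠ ⊤ := hg.neg.lintegral_lt_top.ne
  rw [EReal.coe_sub, EReal.coe_ennreal_toReal h1, EReal.coe_ennreal_toReal h2]

lemma expectation_const [IsProbabilityMeasure P] (r : ℝ) :
    expectation P (fun _ => r) = (r : EReal) := by
  rw [expectation_eq_integral (integrable_const r)]
  simp

lemma integrable_of_expectation_eq_coe {g : Ω → ℝ} (hm : Measurable g) {r : ℝ}
    (h : expectation P g = (r : EReal)) : Integrable g P := by
  unfold expectation at h
  have h2 : ∫⁻ ω, ENNReal.ofReal (-(g ω)) ∂P ≠ ⊤ := by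
    intro h2; rw [h2] at h; simp at h
  have h1 : ∫⁻ ω, ENNReal.ofReal (g ω) ∂P ≠ ⊤ := by
    intro h1
    rw [h1, ← EReal.coe_ennreal_toReal h2] at h
    simp at h
  refine ⟨hm.aestronglyMeasurable, ?_⟩
  rw [hasFiniteIntegral_iff_norm]
  have h3 : ∀ ω, ENNReal.ofReal ‖g ω‖ ≤ ENNReal.ofReal (g ω) + ENNReal.ofReal (-(g ω)) := by
    intro ω
    rw [Real.norm_eq_abs]
    rcases le_total 0 (g ω) with h0 | h0
    · rw [abs_of_nonneg h0]; exact le_self_add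
    · rw [abs_of_nonpos h0]; exact le_add_self
  calc _ ≤ ∫⁻ ω, ENNReal.ofReal (g ω) + ENNReal.ofReal (-(g ω)) ∂P := lintegral_mono h3
    _ = _ := lintegral_add_left hm.ennreal_ofReal _
    _ < ⊤ := ENNReal.add_lt_top.2 ⟨h1.lt_top, h2.lt_top⟩

/-- A function bounded below by an integrable one whose expectation is not `+∞` is integrable. -/
lemma integrable_of_le_of_expectation_le {g h : Ω → ℝ} (hm : Measurable g) (hh : Integrable h P)
    (hle : h ≤ᵐ[P] g) {r : ℝ} (hr : expectation P g ≤ (r : EReal)) : Integrable g P := by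
  have h1 : ((∫ ω, h ω ∂P : ℝ) : EReal) ≤ expectation P g := by
    rw [← expectation_eq_integral hh]; exact expectation_mono hle
  have h2 : expectation P g = ((expectation P g).toReal : EReal) := by
    refine (EReal.coe_toReal ?_ ?_).symm
    · exact (hr.trans_lt (EReal.coe_lt_top r)).ne
    · exact ((EReal.bot_lt_coe _).trans_le h1).ne'
  exact integrable_of_expectation_eq_coe hm h2

end expectation

/-! ### The primitives -/

namespace Env

variable (E : Env)

instance : IsProbabilityMeasure E.F := by
  refine ⟨?_⟩
  have hi : Integrable E.f := by
    by_contra h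
    have := E.f_integral
    rw [integral_undef h] at this
    exact zero_ne_one this
  rw [F, withDensity_apply _ MeasurableSet.univ, Measure.restrict_univ,
    ← ofReal_integral_eq_lintegral_ofReal hi (ae_of_all _ E.f_nonneg), E.f_integral,
    ENNReal.ofReal_one]

instance : IsProbabilityMeasure E.law := by
  change IsProbabilityMeasure (E.F.prod gapLaw)
  infer_instance

lemma law_eq : E.law = E.F.prod gapLaw := rfl

/-- The long-horizon assumption, stated without division, excludes a lowest reward size of zero. -/
lemma vLo_pos : 0 < E.vLo := by
  rcases E.vLo_nonneg.lt_or_eq with h | h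
  · exact h
  · have h1 := E.long_horizon
    rw [← h] at h1
    have := E.mu0_mem.1
    simp at h1
    linarith

lemma ae_mem_Icc : ∀ᵐ v ∂E.F, v ∈ Icc E.vLo E.vHi := by
  rw [F, ae_withDensity_iff (by have := E.f_measurable; fun_prop)]
  refine ae_of_all _ fun v hv => ?_
  rw [← E.f_support]
  refine subset_tsupport _ fun h0 => hv ?_
  rw [h0, ENNReal.ofReal_zero]

lemma lintegral_size : ∫⁻ v, ENNReal.ofReal v ∂E.F = 1 := by
  have hm : Measurable fun v => ENNReal.ofReal (E.f v) := by
    have := E.f_measurable; fun_prop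
  have h1 : Integrable fun v => v * E.f v := by
    by_contra h
    have := E.f_mean
    rw [integral_undef h] at this
    exact zero_ne_one this
  have h0 : ∀ v, 0 ≤ v * E.f v := by
    intro v
    by_cases hv : v ∈ tsupport E.f
    · rw [E.f_support] at hv
      exact mul_nonneg (E.vLo_nonneg.trans hv.1) (E.f_nonneg v)
    · rw [image_eq_zero_of_notMem_tsupport hv, mul_zero]
  rw [F, lintegral_withDensity_eq_lintegral_mul _ hm (by fun_prop)]
  simp only [Pi.mul_apply]
  calc _ = ∫⁻ v, ENNReal.ofReal (v * E.f v) := by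
        refine lintegral_congr fun v => ?_
        rw [mul_comm v, ENNReal.ofReal_mul (E.f_nonneg v)]
    _ = _ := by
        rw [← ofReal_integral_eq_lintegral_ofReal h1 (ae_of_all _ h0), E.f_mean,
          ENNReal.ofReal_one]

lemma ae_isState : ∀ᵐ ω ∂E.law, IsState E ω := by
  rw [law_eq]
  have h1 : ∀ᵐ ω ∂E.F.prod gapLaw, ω.1 ∈ Icc E.vLo E.vHi :=
    Measure.quasiMeasurePreserving_fst.ae E.ae_mem_Icc
  have h2 : ∀ᵐ ω ∂E.F.prod gapLaw, (∀ k, 0 < ω.2 k) :=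
    Measure.quasiMeasurePreserving_snd.ae ae_gap_pos
  have h3 : ∀ᵐ ω ∂E.F.prod gapLaw, Filter.Tendsto (point ω.2) Filter.atTop Filter.atTop :=
    Measure.quasiMeasurePreserving_snd.ae ae_tendsto_point
  filter_upwards [h1, h2, h3] with ω a b c using ⟨a, b, c⟩

end Env

lemma IsState.finite_points {E : Env} {ω : ℝ × (ℕ → ℝ)} (h : IsState E ω) (a : ℝ) :
    {k | point ω.2 k ≤ a}.Finite := by
  have h1 := h.2.2
  rw [← Nat.cofinite_eq_atTop] at h1
  have h2 := h1.eventually_gt_atTop a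
  rw [Filter.eventually_cofinite] at h2
  simpa using h2

lemma IsState.point_mono {E : Env} {ω : ℝ × (ℕ → ℝ)} (h : IsState E ω) :
    Monotone (point ω.2) :=
  monotone_nat_of_le_succ fun k => by rw [point_succ]; linarith [h.2.1 (k + 1)]

lemma IsState.ncard_pos_iff {E : Env} {ω : ℝ × (ℕ → ℝ)} (h : IsState E ω) (a : ℝ) :
    0 < {k | point ω.2 k ≤ a}.ncard ↔ ω.2 0 ≤ a := by
  rw [Set.ncard_pos (h.finite_points a)]
  constructor
  · rintro ⟨k, hk⟩
    rw [← point_zero ω.2]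
    exact (h.point_mono (Nat.zero_le k)).trans hk
  · intro h0
    exact ⟨0, by simpa [point_zero] using h0⟩

lemma IsState.one_lt_ncard {E : Env} {ω : ℝ × (ℕ → ℝ)} (hω : IsState E ω) {a : ℝ}
    (h : ω.2 0 + ω.2 1 ≤ a) : 1 < {k | point ω.2 k ≤ a}.ncard := by
  rw [Set.one_lt_ncard (hω.finite_points a)]
  refine ⟨0, ?_, 1, ?_, zero_ne_one⟩
  · have := hω.2.1 1
    simp only [mem_ofPred_eq, point_zero]; linarith
  · simpa [point_succ, point_zero] using h

lemma IsState.ncard_le_one {E : Env} {ω : ℝ × (ℕ → ℝ)} (hω : IsState E ω) {a : ℝ}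
    (h : a < ω.2 0 + ω.2 1) : {k | point ω.2 k ≤ a}.ncard ≤ 1 := by
  have hsub : {k | point ω.2 k ≤ a} ⊆ {0} := by
    intro k hk
    by_contra hk0
    have h1 := hω.point_mono (Nat.one_le_iff_ne_zero.2 hk0)
    rw [point_succ, point_zero] at h1
    have h2 : point ω.2 k ≤ a := hk
    simp only [zero_add] at h1
    linarith
  exact (Set.ncard_le_ncard hsub).trans (by simp)

/-- Value of the rewards received until the Poisson clock shows `a`. -/
def rewards (ω : ℝ × (ℕ → ℝ)) (a : ℝ) : ℝ := ({k | point ω.2 k ≤ a}.ncard : ℝ) * ω.1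

lemma rewards_nonneg {E : Env} {ω : ℝ × (ℕ → ℝ)} (h : IsState E ω) (a : ℝ) : 0 ≤ rewards ω a :=
  mul_nonneg (by positivity) (E.vLo_nonneg.trans h.1.1)

lemma rewards_mono {E : Env} {ω : ℝ × (ℕ → ℝ)} (h : IsState E ω) {a b : ℝ} (hab : a ≤ b) :
    rewards ω a ≤ rewards ω b := by
  unfold rewards
  have h1 : {k | point ω.2 k ≤ a}.ncard ≤ {k | point ω.2 k ≤ b}.ncard :=
    Set.ncard_le_ncard (fun k (hk : _ ≤ a) => hk.trans hab) (h.finite_points b)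
  exact mul_le_mul_of_nonneg_right (by exact_mod_cast h1) (E.vLo_nonneg.trans h.1.1)

lemma measurable_rewards {a : ℝ × (ℕ → ℝ) → ℝ} (ha : Measurable a) :
    Measurable fun ω => rewards ω (a ω) := by
  unfold rewards
  simp_rw [ncard_point_le]
  have := measurable_numPoints.comp (measurable_snd.prodMk ha)
  exact this.ennreal_toReal.mul measurable_fst

lemma lintegral_rewards (E : Env) (a : ℝ) :
    ∫⁻ ω, ENNReal.ofReal (rewards ω a) ∂E.law = ENNReal.ofReal a := by
  have h : ∀ᵐ ω ∂E.law, ENNReal.ofReal (rewards ω a) =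
      ENNReal.ofReal ω.1 * numPoints ω.2 a := by
    have hfin : ∀ᵐ e ∂gapLaw, numPoints e a < ⊤ := by
      refine ae_lt_top (measurable_numPoints.comp (by fun_prop : Measurable fun e => (e, a))) ?_
      rw [lintegral_numPoints]; exact ENNReal.ofReal_ne_top
    have hfin' : ∀ᵐ ω ∂E.law, numPoints ω.2 a < ⊤ := by
      rw [E.law_eq]; exact Measure.quasiMeasurePreserving_snd.ae hfin
    filter_upwards [hfin'] with ω hω
    rw [rewards, ncard_point_le, ENNReal.ofReal_mul ENNReal.toReal_nonneg,
      ENNReal.ofReal_toReal hω.ne, mul_comm]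
  rw [lintegral_congr_ae h, E.law_eq,
    lintegral_prod_mul (f := fun v => ENNReal.ofReal v) (g := fun e => numPoints e a)
      (by fun_prop)
      (measurable_numPoints.comp (by fun_prop : Measurable fun e => (e, a))).aemeasurable,
    E.lintegral_size, lintegral_numPoints, one_mul]

lemma ae_rewards_nonneg (E : Env) (a : ℝ) : 0 ≤ᵐ[E.law] fun ω => rewards ω a := by
  filter_upwards [E.ae_isState] with ω hω
  exact rewards_nonneg hω a

lemma integrable_rewards (E : Env) (a : ℝ) : Integrable (fun ω => rewards ω a) E.law := by
  refine ⟨(measurable_rewards measurable_const).aestronglyMeasurable, ?_⟩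
  rw [hasFiniteIntegral_iff_ofReal (ae_rewards_nonneg E a), lintegral_rewards]
  exact ENNReal.ofReal_lt_top

/-- The points of the process come at rate one, and a reward is worth `𝔼[v] = 1` on average. -/
lemma integral_rewards (E : Env) {a : ℝ} (ha : 0 ≤ a) : ∫ ω, rewards ω a ∂E.law = a := by
  rw [integral_eq_lintegral_of_nonneg_ae (ae_rewards_nonneg E a)
    (measurable_rewards measurable_const).aestronglyMeasurable, lintegral_rewards,
    ENNReal.toReal_ofReal ha]

lemma expectation_rewards_sub_const (E : Env) {a : ℝ} (ha : 0 ≤ a) (p : ℝ) :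
    expectation E.law (fun ω => rewards ω a - p) = ((a - p : ℝ) : EReal) := by
  have hi : Integrable (fun ω => rewards ω a - p) E.law :=
    (integrable_rewards E a).sub (integrable_const p)
  rw [expectation_eq_integral hi, integral_sub (integrable_rewards E a) (integrable_const p),
    integral_rewards E ha]
  simp

/-! ### Clocks and arrival times -/

lemma intervalIntegrable_of_mem {g : ℝ → ℝ} (hg : Measurable g) {T : ℝ}
    (h : ∀ t ∈ Icc 0 T, g t ∈ Icc (0 : ℝ) 1) {a b : ℝ} (ha : a ∈ Icc 0 T) (hb : b ∈ Icc 0 T) :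
    IntervalIntegrable g volume a b := by
  rw [intervalIntegrable_iff]
  refine Measure.integrableOn_of_bounded (M := 1) (by simp) hg.aestronglyMeasurable ?_
  filter_upwards [ae_restrict_mem measurableSet_uIoc] with t ht
  have ht' : t ∈ Icc 0 T := (uIcc_subset_Icc ha hb) (uIoc_subset_uIcc ht)
  rw [Real.norm_eq_abs, abs_le]
  have := h t ht'
  exact ⟨by linarith [this.1], this.2⟩

lemma integral_le_of_mem {g : ℝ → ℝ} (hg : Measurable g) {T : ℝ}
    (h : ∀ t ∈ Icc 0 T, g t ∈ Icc (0 : ℝ) 1) {t : ℝ} (ht : t ∈ Icc 0 T) :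
    ∫ s in (0 : ℝ)..t, g s ≤ t := by
  have h0 : (0 : ℝ) ∈ Icc 0 T := ⟨le_rfl, ht.1.trans ht.2⟩
  calc ∫ s in (0 : ℝ)..t, g s ≤ ∫ s in (0 : ℝ)..t, (1 : ℝ) :=
        intervalIntegral.integral_mono_on ht.1 (intervalIntegrable_of_mem hg h h0 ht)
          (by simp) fun s hs => (h s ⟨hs.1, hs.2.trans ht.2⟩).2
    _ = t := by simp

namespace Mechanism

variable {E : Env} (M : Mechanism E)

/-- Reading at time `t` of the clock on which the Poisson process of rewards runs. -/
def clock (q : Quality) (c : Conduct) (t : ℝ) : ℝ := E.lam * ∫ s in (0 : ℝ)..t, M.access q c s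

/-- The clock as long as the buyer has not reported a reward. -/
def silentClock (q : Quality) (t : ℝ) : ℝ := E.lam * ∫ s in (0 : ℝ)..t, M.IU q s

/-- Arrival time of the first reward when the first gap of the Poisson process is `x` and the buyer
has not reported; it is `T` if there is no arrival before `T`. -/
def arrival (q : Quality) (x : ℝ) : ℝ :=
  sInf ({t | t ∈ Icc 0 E.T ∧ x ≤ M.silentClock q t} ∪ {E.T})

lemma access_mem {q : Quality} {c : Conduct} (hs : 0 < c.reportTime)
    (hv : c.reportValue ∈ Icc E.vLo E.vHi) {t : ℝ} (ht : t ∈ Icc 0 E.T) :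
    M.access q c t ∈ Icc (0 : ℝ) 1 := by
  unfold access
  split_ifs with h
  · exact M.IR_mem q _ hv _ _ hs h ht.2
  · exact M.IU_mem q t ht

lemma measurable_access (q : Quality) (c : Conduct) : Measurable (M.access q c) := by
  unfold access
  refine Measurable.ite measurableSet_Ioi ?_ (M.IU_measurable q)
  exact (M.IR_measurable q).comp
    (by fun_prop : Measurable fun t : ℝ => (c.reportValue, c.reportTime, t))

lemma clock_le {q : Quality} {c : Conduct} (hs : 0 < c.reportTime)
    (hv : c.reportValue ∈ Icc E.vLo E.vHi) {t : ℝ} (ht : t ∈ Icc 0 E.T) :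
    M.clock q c t ≤ E.lam * E.T := by
  refine mul_le_mul_of_nonneg_left ?_ E.lam_pos.le
  exact (integral_le_of_mem (M.measurable_access q c)
    (fun t ht => M.access_mem hs hv ht) ht).trans ht.2

lemma silentClock_le {q : Quality} {t : ℝ} (ht : t ∈ Icc 0 E.T) :
    M.silentClock q t ≤ E.lam * t :=
  mul_le_mul_of_nonneg_left
    (integral_le_of_mem (M.IU_measurable q) (M.IU_mem q) ht) E.lam_pos.le

lemma silentClock_mono {q : Quality} {s t : ℝ} (hs : s ∈ Icc 0 E.T) (ht : t ∈ Icc 0 E.T)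
    (hst : s ≤ t) : M.silentClock q s ≤ M.silentClock q t := by
  have h0 : (0 : ℝ) ∈ Icc 0 E.T := ⟨le_rfl, E.T_pos.le⟩
  refine mul_le_mul_of_nonneg_left ?_ E.lam_pos.le
  rw [← intervalIntegral.integral_add_adjacent_intervals
    (intervalIntegrable_of_mem (M.IU_measurable q) (M.IU_mem q) h0 hs)
    (intervalIntegrable_of_mem (M.IU_measurable q) (M.IU_mem q) hs ht)]
  have := intervalIntegral.integral_nonneg (μ := volume) (f := M.IU q) hst
    fun u hu => (M.IU_mem q u ⟨hs.1.trans hu.1, hu.2.trans ht.2⟩).1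
  linarith

lemma clock_eq_silentClock {q : Quality} {c : Conduct} {t : ℝ} (ht : 0 ≤ t)
    (h : t ≤ c.reportTime) : M.clock q c t = M.silentClock q t := by
  unfold clock silentClock
  congr 1
  refine intervalIntegral.integral_congr fun s hs => ?_
  rw [uIcc_of_le ht] at hs
  simp [access, not_lt.2 (hs.2.trans h)]

lemma isClosed_arrivalSet (q : Quality) (x : ℝ) :
    IsClosed ({t | t ∈ Icc 0 E.T ∧ x ≤ M.silentClock q t} ∪ {E.T}) := by
  refine IsClosed.union ?_ isClosed_singleton
  have hc : ContinuousOn (M.silentClock q) (Icc 0 E.T) := by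
    refine ContinuousOn.mul continuousOn_const ?_
    have := intervalIntegral.continuousOn_primitive_interval (f := M.IU q) (μ := volume)
      (a := 0) (b := E.T) ?_
    · rwa [uIcc_of_le E.T_pos.le] at this
    · rw [uIcc_of_le E.T_pos.le, integrableOn_Icc_iff_integrableOn_Ioc,
        ← intervalIntegrable_iff_integrableOn_Ioc_of_le E.T_pos.le]
      exact intervalIntegrable_of_mem (M.IU_measurable q) (M.IU_mem q)
        ⟨le_rfl, E.T_pos.le⟩ ⟨E.T_pos.le, le_rfl⟩
  exact hc.preimage_isClosed_of_isClosed isClosed_Icc isClosed_Ici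

lemma bddBelow_arrivalSet (q : Quality) (x : ℝ) :
    BddBelow ({t | t ∈ Icc 0 E.T ∧ x ≤ M.silentClock q t} ∪ {E.T}) := by
  refine ⟨0, ?_⟩
  rintro t (ht | rfl)
  exacts [ht.1.1, E.T_pos.le]

lemma arrival_mem_arrivalSet (q : Quality) (x : ℝ) :
    M.arrival q x ∈ {t | t ∈ Icc 0 E.T ∧ x ≤ M.silentClock q t} ∪ {E.T} :=
  (M.isClosed_arrivalSet q x).csInf_mem ⟨E.T, Or.inr rfl⟩ (M.bddBelow_arrivalSet q x)

lemma arrival_le_T (q : Quality) (x : ℝ) : M.arrival q x ≤ E.T :=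
  csInf_le (M.bddBelow_arrivalSet q x) (Or.inr rfl)

lemma arrival_le {q : Quality} {x t : ℝ} (ht : t ∈ Icc 0 E.T) (hx : x ≤ M.silentClock q t) :
    M.arrival q x ≤ t :=
  csInf_le (M.bddBelow_arrivalSet q x) (Or.inl ⟨ht, hx⟩)

/-- The first reward arrives exactly when the clock reaches the first gap. -/
lemma le_silentClock_arrival {q : Quality} {x : ℝ} (h : M.arrival q x < E.T) :
    x ≤ M.silentClock q (M.arrival q x) := by
  rcases M.arrival_mem_arrivalSet q x with h1 | h1
  · exact h1.2
  · exact absurd h1 h.ne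

lemma min_le_arrival (q : Quality) (x : ℝ) : min (x / E.lam) E.T ≤ M.arrival q x := by
  rcases M.arrival_mem_arrivalSet q x with h1 | h1
  · refine (min_le_left _ _).trans ?_
    rw [div_le_iff₀ E.lam_pos, mul_comm]
    exact h1.2.trans (M.silentClock_le h1.1)
  · rw [mem_singleton_iff] at h1
    rw [h1]; exact min_le_right _ _

lemma arrival_mem {q : Quality} {x : ℝ} (hx : 0 < x) : M.arrival q x ∈ Ioc 0 E.T :=
  ⟨(lt_min (div_pos hx E.lam_pos) E.T_pos).trans_le (M.min_le_arrival q x), M.arrival_le_T q x⟩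

lemma arrival_eq_T_of_le {q : Quality} {x : ℝ} (hx : E.lam * E.T ≤ x) : M.arrival q x = E.T := by
  refine le_antisymm (M.arrival_le_T q x) (le_trans (le_min ?_ le_rfl) (M.min_le_arrival q x))
  rwa [le_div_iff₀ E.lam_pos, mul_comm]

lemma arrival_eq_T_of_lt {q : Quality} {x : ℝ} (hx : M.silentClock q E.T < x) :
    M.arrival q x = E.T := by
  rcases M.arrival_mem_arrivalSet q x with h1 | h1
  · exact absurd (h1.2.trans (M.silentClock_mono h1.1 ⟨E.T_pos.le, le_rfl⟩ h1.1.2)) (not_le.2 hx)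
  · exact h1

lemma monotone_arrival (q : Quality) : Monotone (M.arrival q) := fun x _ hxy =>
  csInf_le_csInf (M.bddBelow_arrivalSet q x) ⟨E.T, Or.inr rfl⟩
    (union_subset_union_left _ fun _ ht => ⟨ht.1, hxy.trans ht.2⟩)

lemma silentClock_congr {q q' : Quality} {t : ℝ} (h0 : 0 ≤ t)
    (h : ∀ s ∈ Ico 0 t, M.IU q s = M.IU q' s) : M.silentClock q t = M.silentClock q' t := by
  unfold silentClock
  congr 1
  refine intervalIntegral.integral_congr_ae ?_
  filter_upwards [Measure.ae_ne volume t] with s hs hst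
  rw [uIoc_of_le h0] at hst
  exact h s ⟨hst.1.le, lt_of_le_of_ne hst.2 hs⟩

/-! ### Truthful conduct -/

/-- The truthful conduct, in the form that is measurable in the chance moves: a buyer who faces
quality `θ` after the seller's report `q` reports the first reward at its arrival. -/
def response (θ q : Quality) (ω : ℝ × (ℕ → ℝ)) : Conduct where
  reportTime := match θ with
    | .low => E.T
    | .high => M.arrival q (ω.2 0)
  reportValue := ω.1
  exitTime := E.T

lemma truthful_eq_response {ω : ℝ × (ℕ → ℝ)} (h : IsState E ω) (θ q : Quality) :
    M.truthful θ q ω = M.response θ q ω := by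
  cases θ with
  | low => simp [truthful, response, count]
  | high =>
    simp only [truthful, response, arrival, Conduct.mk.injEq, and_true]
    congr 2
    ext t
    refine and_congr_right fun ht => ?_
    rw [← M.clock_eq_silentClock (c := ⟨E.T, ω.1, E.T⟩) ht.1 ht.2]
    exact h.ncard_pos_iff _

lemma response_reportTime_mem {ω : ℝ × (ℕ → ℝ)} (h : IsState E ω) (θ q : Quality) :
    (M.response θ q ω).reportTime ∈ Ioc 0 E.T := by
  cases θ with
  | low => exact ⟨E.T_pos, le_rfl⟩
  | high => exact M.arrival_mem (h.2.1 0)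

/-- Final price, for true quality `θ` and report `q` of the seller, against a truthful buyer. -/
def finalPrice (θ q : Quality) (ω : ℝ × (ℕ → ℝ)) : ℝ := M.price q (M.response θ q ω) E.T

lemma finalPrice_low (q : Quality) (ω : ℝ × (ℕ → ℝ)) : M.finalPrice .low q ω = M.pU q E.T := by
  simp [finalPrice, price, response]

lemma measurable_arrival_gap (q : Quality) :
    Measurable fun ω : ℝ × (ℕ → ℝ) => M.arrival q (ω.2 0) :=
  (M.monotone_arrival q).measurable.comp (by fun_prop)

lemma measurable_finalPrice (θ q : Quality) : Measurable (M.finalPrice θ q) := by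
  cases θ with
  | low => simp_rw [funext (M.finalPrice_low q)]; exact measurable_const
  | high =>
    have := M.measurable_arrival_gap q
    unfold finalPrice price response
    refine Measurable.ite (measurableSet_lt this measurable_const) ?_ measurable_const
    exact (M.pR_measurable q).comp (measurable_fst.prodMk (this.prodMk measurable_const))

lemma sellerPayoff_eq (θ q : Quality) :
    M.sellerPayoff θ q = expectation E.law (M.finalPrice θ q) := by
  refine expectation_congr ?_
  filter_upwards [E.ae_isState] with ω hω
  rw [M.truthful_eq_response hω, finalPrice]

/-- Final reading of the clock when the quality is high, the seller and the buyer are truthful, the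
rewards have size `v` and the first gap of the Poisson process is `x`. -/
def finalClock (v x : ℝ) : ℝ := M.clock .high ⟨M.arrival .high x, v, E.T⟩ E.T

lemma measurable_finalClock : Measurable fun p : ℝ × ℝ => M.finalClock p.1 p.2 := by
  unfold finalClock clock
  refine Measurable.const_mul ?_ _
  simp_rw [intervalIntegral.integral_of_le E.T_pos.le]
  refine (StronglyMeasurable.integral_prod_right
    (f := fun (p : ℝ × ℝ) (s : ℝ) => M.access .high ⟨M.arrival .high p.2, p.1, E.T⟩ s)
    ?_).measurable
  refine Measurable.stronglyMeasurable ?_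
  have ha : Measurable fun p : (ℝ × ℝ) × ℝ => M.arrival .high p.1.2 :=
    (M.monotone_arrival .high).measurable.comp (by fun_prop)
  unfold Function.uncurry access
  refine Measurable.ite (measurableSet_lt ha measurable_snd) ?_
    ((M.IU_measurable _).comp measurable_snd)
  exact (M.IR_measurable _).comp
    ((measurable_fst.comp measurable_fst).prodMk (ha.prodMk measurable_snd))

lemma finalClock_le {ω : ℝ × (ℕ → ℝ)} (h : IsState E ω) :
    M.finalClock ω.1 (ω.2 0) ≤ E.lam * E.T :=
  M.clock_le (M.arrival_mem (h.2.1 0)).1 h.1 ⟨E.T_pos.le, le_rfl⟩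

lemma finalClock_of_arrival_eq {v x : ℝ} (h : M.arrival .high x = E.T) :
    M.finalClock v x = M.silentClock .high E.T :=
  M.clock_eq_silentClock E.T_pos.le h.ge

lemma buyerPayoffGiven_high_truthful :
    M.buyerPayoffGiven .high (fun ω => M.truthful .high .high ω) =
      expectation E.law fun ω =>
        rewards ω (M.finalClock ω.1 (ω.2 0)) - M.finalPrice .high .high ω := by
  refine expectation_congr ?_
  filter_upwards [E.ae_isState] with ω hω
  rw [M.truthful_eq_response hω]
  rfl

lemma buyerPayoffGiven_low_truthful :
    M.buyerPayoffGiven .low (fun ω => M.truthful .low .low ω) = ((-M.pU .low E.T : ℝ) : EReal) := by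
  rw [← expectation_const (P := E.law)]
  refine expectation_congr ?_
  filter_upwards [E.ae_isState] with ω hω
  rw [M.truthful_eq_response hω]
  simp [count, price, response]

/-! ### Simulating an arrival -/

/-- The arrival times of a fixed first gap after two reports of the seller agree if one of them
comes while the observed access is the same: up to then, the two silent clocks coincide. -/
lemma arrival_eq_of_access_eq {x : ℝ} {q q' : Quality} {c c' : Conduct} (hx : 0 < x)
    (hc : c.reportTime = M.arrival q x) (hc' : c'.reportTime = M.arrival q' x)
    (h : ∀ s ∈ Ico 0 (M.arrival q x), M.access q c s = M.access q' c' s) :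
    M.arrival q' x = M.arrival q x := by
  have hIU : ∀ m, m ≤ M.arrival q x → m ≤ M.arrival q' x → ∀ s ∈ Ico 0 m,
      M.IU q s = M.IU q' s := by
    intro m hm hm' s hs
    have := h s ⟨hs.1, hs.2.trans_le hm⟩
    rwa [access, access, if_neg (by rw [hc]; exact not_lt.2 (hs.2.le.trans hm)),
      if_neg (by rw [hc']; exact not_lt.2 (hs.2.le.trans hm'))] at this
  have ht := M.arrival_mem (q := q) hx
  have ht' := M.arrival_mem (q := q') hx
  refine le_antisymm ?_ ?_
  · by_contra hlt
    rw [not_le] at hlt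
    have h1 := M.le_silentClock_arrival (hlt.trans_le ht'.2)
    rw [M.silentClock_congr ht.1.le (hIU _ le_rfl hlt.le)] at h1
    exact absurd (M.arrival_le ⟨ht.1.le, ht.2⟩ h1) (not_le.2 hlt)
  · by_contra hlt
    rw [not_le] at hlt
    have h1 := M.le_silentClock_arrival (hlt.trans_le ht.2)
    rw [← M.silentClock_congr ht'.1.le (hIU _ hlt.le le_rfl)] at h1
    exact absurd (M.arrival_le ⟨ht'.1.le, ht'.2⟩ h1) (not_le.2 hlt)

/-- The buyer ignores the actual rewards and behaves as a truthful buyer who faces quality `τ`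
would do in the fixed realization `ω'`. The report depends on the seller's message only through
the access before it, so that the buyer need not know the message. -/
def simulate (τ : Quality) (ω' : ℝ × (ℕ → ℝ)) (hω' : IsState E ω') : M.BuyerStrategy where
  conduct θ _ := M.response τ θ ω'
  reportTime_measurable _ := measurable_const
  reportValue_measurable _ := measurable_const
  exitTime_measurable _ := measurable_const
  reportTime_mem θ _ _ := M.response_reportTime_mem hω' τ θ
  reportValue_mem _ _ _ := hω'.1
  exitTime_mem _ _ _ := ⟨E.T_pos.le, le_rfl⟩
  nonanticipating := by
    intro θ θ' ω₁ ω₂ _ _ t _ hobs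
    refine ⟨?_, fun _ _ => rfl, Iff.rfl⟩
    cases τ with
    | low => exact Iff.rfl
    | high =>
      constructor
      · intro h
        change M.arrival θ (ω'.2 0) = t at h
        subst h
        exact M.arrival_eq_of_access_eq (hω'.2.1 0) rfl rfl fun s hs => (hobs.2.2 s hs).1
      · intro h
        change M.arrival θ' (ω'.2 0) = t at h
        subst h
        exact M.arrival_eq_of_access_eq (hω'.2.1 0) rfl rfl fun s hs => (hobs.2.2 s hs).1.symm

/-- Payoff of a simulating buyer whose access is full whenever the quality is high. -/
lemma buyerPayoff_simulate (τ : Quality) {ω' : ℝ × (ℕ → ℝ)} (hω' : IsState E ω')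
    (hfull : M.clock .high (M.response τ .high ω') E.T = E.lam * E.T) :
    M.buyerPayoff (M.simulate τ ω' hω').conduct =
      ((E.mu0 * (E.lam * E.T - M.finalPrice τ .high ω') +
        (1 - E.mu0) * (-M.finalPrice τ .low ω') : ℝ) : EReal) := by
  have h1 : M.buyerPayoffGiven .high ((M.simulate τ ω' hω').conduct .high) =
      ((E.lam * E.T - M.finalPrice τ .high ω' : ℝ) : EReal) := by
    have h : ∀ ω : ℝ × (ℕ → ℝ), (M.count .high .high (M.response τ .high ω') ω.2
        (M.response τ .high ω').exitTime : ℝ) * ω.1 = rewards ω (E.lam * E.T) := by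
      intro ω; rw [← hfull]; rfl
    change expectation E.law (fun ω => (M.count .high .high (M.response τ .high ω') ω.2
        (M.response τ .high ω').exitTime : ℝ) * ω.1 - M.finalPrice τ .high ω') = _
    simp_rw [h]
    exact expectation_rewards_sub_const E (mul_pos E.lam_pos E.T_pos).le _
  have h2 : M.buyerPayoffGiven .low ((M.simulate τ ω' hω').conduct .low) =
      ((-M.finalPrice τ .low ω' : ℝ) : EReal) := by
    rw [← expectation_const (P := E.law)]
    refine expectation_congr (ae_of_all _ fun ω => ?_)
    change ((0 : ℕ) : ℝ) * ω.1 - M.finalPrice τ .low ω' = _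
    simp
  rw [buyerPayoff, h1, h2]
  norm_cast

end Mechanism

/-! ### Selling ex ante -/

section sellExAnte

variable (E : Env)

lemma price_sellExAnte (q : Quality) (c : Conduct) (t : ℝ) :
    (sellExAnte E).price q c t = E.lam * E.mu0 * E.T := by
  simp [Mechanism.price, sellExAnte]

lemma clock_sellExAnte (q : Quality) (c : Conduct) (t : ℝ) :
    (sellExAnte E).clock q c t = E.lam * t := by
  simp [Mechanism.clock, Mechanism.access, sellExAnte]

lemma sellerPayoff_sellExAnte (θ q : Quality) :
    (sellExAnte E).sellerPayoff θ q = ((E.lam * E.mu0 * E.T : ℝ) : EReal) := by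
  unfold Mechanism.sellerPayoff
  simp_rw [price_sellExAnte]
  exact expectation_const _

/-- Without access restrictions, no conduct yields more than the expected number of rewards that
arrive in `[0, T]`. -/
lemma buyerPayoff_sellExAnte_le (σ : (sellExAnte E).BuyerStrategy) :
    (sellExAnte E).buyerPayoff σ.conduct ≤ 0 := by
  have hT := (mul_pos E.lam_pos E.T_pos).le
  have h1 : (sellExAnte E).buyerPayoffGiven .high (σ.conduct .high) ≤
      ((E.lam * E.T - E.lam * E.mu0 * E.T : ℝ) : EReal) := by
    rw [← expectation_rewards_sub_const E hT]
    refine expectation_mono ?_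
    filter_upwards [E.ae_isState] with ω hω
    rw [price_sellExAnte]
    refine sub_le_sub_right ?_ _
    exact rewards_mono hω ((sellExAnte E).clock_le (σ.reportTime_mem .high ω hω).1
      (σ.reportValue_mem .high ω hω) (σ.exitTime_mem .high ω hω))
  have h2 : (sellExAnte E).buyerPayoffGiven .low (σ.conduct .low) =
      ((-(E.lam * E.mu0 * E.T) : ℝ) : EReal) := by
    rw [← expectation_const (P := E.law)]
    refine expectation_congr (ae_of_all _ fun ω => ?_)
    beta_reduce
    rw [price_sellExAnte]
    simp [Mechanism.count]
  have h3 : (E.mu0 : EReal) * (sellExAnte E).buyerPayoffGiven .high (σ.conduct .high) ≤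
      (E.mu0 : EReal) * ((E.lam * E.T - E.lam * E.mu0 * E.T : ℝ) : EReal) :=
    mul_le_mul_of_nonneg_left h1 (EReal.coe_nonneg.2 E.mu0_mem.1.le)
  rw [Mechanism.buyerPayoff, h2]
  refine (add_le_add_left h3 _).trans (le_of_eq ?_)
  norm_cast
  ring

lemma buyerPayoff_sellExAnte_truthful :
    ((sellExAnte E).buyerPayoff fun θ ω => (sellExAnte E).truthful θ θ ω) = 0 := by
  have h1 : (sellExAnte E).buyerPayoffGiven .high
      (fun ω => (sellExAnte E).truthful .high .high ω) =
        ((E.lam * E.T - E.lam * E.mu0 * E.T : ℝ) : EReal) := by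
    rw [Mechanism.buyerPayoffGiven_high_truthful,
      ← expectation_rewards_sub_const E (mul_pos E.lam_pos E.T_pos).le]
    refine expectation_congr (ae_of_all _ fun ω => ?_)
    simp only [Mechanism.finalClock, clock_sellExAnte, Mechanism.finalPrice, price_sellExAnte]
  rw [Mechanism.buyerPayoff, h1, Mechanism.buyerPayoffGiven_low_truthful]
  simp only [sellExAnte]
  norm_cast
  ring

lemma isICIR_sellExAnte : (sellExAnte E).IsICIR where
  seller_ic θ q := by simp_rw [sellerPayoff_sellExAnte]; exact le_rfl
  buyer_ic σ := by
    rw [buyerPayoff_sellExAnte_truthful]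
    exact buyerPayoff_sellExAnte_le E σ
  seller_ir θ := by
    rw [sellerPayoff_sellExAnte]
    have := E.mu0_mem.1
    have := E.lam_pos
    have := E.T_pos
    exact EReal.coe_nonneg.2 (by positivity)
  buyer_ir := (buyerPayoff_sellExAnte_truthful E).ge

end sellExAnte

/-! ### Efficiency of a mechanism that attains the bound -/

lemma expMeasure_Ioc_pos {a b : ℝ} (hab : a < b) (hb : 0 < b) : expMeasure 1 (Ioc a b) ≠ 0 := by
  rw [expMeasure_one_eq, Ne, withDensity_apply_eq_zero (measurable_erlang 0)]
  have hsub : Ioc (max a 0) b ⊆ {x | erlang 0 x ≠ 0} ∩ Ioc a b := by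
    intro x hx
    have h0 : 0 < x := (le_max_right _ _).trans_lt hx.1
    refine ⟨?_, (le_max_left _ _).trans_lt hx.1, hx.2⟩
    simp [erlang, h0.le, Real.exp_pos]
  intro h
  have := measure_mono_null hsub h
  rw [Real.volume_Ioc, ENNReal.ofReal_eq_zero, sub_nonpos] at this
  exact absurd this (not_le.2 (max_lt hab hb))

/-- The reward size, the first gap and the second gap are independent. -/
lemma measurePreserving_size_gaps (E : Env) :
    MeasurePreserving (fun ω : ℝ × (ℕ → ℝ) => ((ω.1, ω.2 0), ω.2 1)) E.law
      ((E.F.prod (expMeasure 1)).prod (expMeasure 1)) := by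
  have h1 : MeasurePreserving (fun e : ℕ → ℝ => (e 0, e 1)) gapLaw
      ((expMeasure 1).prod (expMeasure 1)) :=
    ⟨by fun_prop, Measure.infinitePi_map_eval_prod (P := fun _ : ℕ => expMeasure 1) zero_ne_one⟩
  have h2 := (measurePreserving_prodAssoc E.F (expMeasure 1) (expMeasure 1)).symm
  exact h2.comp ((MeasurePreserving.id E.F).prod h1)

namespace Mechanism

variable {E : Env} (M : Mechanism E)

lemma integrable_rewards_finalClock :
    Integrable (fun ω => rewards ω (M.finalClock ω.1 (ω.2 0))) E.law := by
  have hp : Measurable fun ω : ℝ × (ℕ → ℝ) => (ω.1, ω.2 0) := by fun_prop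
  have hm := M.measurable_finalClock.comp hp
  have hr := measurable_rewards hm
  refine (integrable_rewards E (E.lam * E.T)).mono' hr.aestronglyMeasurable ?_
  filter_upwards [E.ae_isState] with ω hω
  rw [Real.norm_of_nonneg (rewards_nonneg hω _)]
  exact rewards_mono hω (M.finalClock_le hω)

lemma integral_rewards_finalClock_le :
    ∫ ω, rewards ω (M.finalClock ω.1 (ω.2 0)) ∂E.law ≤ E.lam * E.T := by
  rw [← integral_rewards E (mul_pos E.lam_pos E.T_pos).le]
  refine integral_mono_ae M.integrable_rewards_finalClock (integrable_rewards E _) ?_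
  filter_upwards [E.ae_isState] with ω hω
  exact rewards_mono hω (M.finalClock_le hω)

variable {M}

/-- If the truthful buyer receives in expectation all the rewards that full access could yield, then
almost surely no point of the Poisson process is missed. -/
lemma ae_ncard_eq (h : E.lam * E.T ≤ ∫ ω, rewards ω (M.finalClock ω.1 (ω.2 0)) ∂E.law) :
    ∀ᵐ ω ∂E.law, {k | point ω.2 k ≤ M.finalClock ω.1 (ω.2 0)}.ncard =
      {k | point ω.2 k ≤ E.lam * E.T}.ncard := by
  have hle : (fun ω => rewards ω (M.finalClock ω.1 (ω.2 0))) ≤ᵐ[E.law]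
      fun ω => rewards ω (E.lam * E.T) := by
    filter_upwards [E.ae_isState] with ω hω
    exact rewards_mono hω (M.finalClock_le hω)
  have heq := (integral_eq_iff_of_ae_le M.integrable_rewards_finalClock
    (integrable_rewards E _) hle).1 (le_antisymm
      (integral_mono_ae M.integrable_rewards_finalClock (integrable_rewards E _) hle)
      (by rwa [integral_rewards E (mul_pos E.lam_pos E.T_pos).le]))
  filter_upwards [heq, E.ae_isState] with ω h1 hω
  have hv : ω.1 ≠ 0 := (E.vLo_pos.trans_le hω.1.1).ne'
  exact_mod_cast mul_right_cancel₀ hv h1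

/-- Access is full as long as the buyer has not reported; otherwise the first gap would
fall with positive probability between the silent clock at `T` and `λ T`, and the first reward would
be missed. -/
lemma silentClock_eq (h : E.lam * E.T ≤ ∫ ω, rewards ω (M.finalClock ω.1 (ω.2 0)) ∂E.law) :
    M.silentClock .high E.T = E.lam * E.T := by
  refine le_antisymm (M.silentClock_le ⟨E.T_pos.le, le_rfl⟩) ?_
  by_contra hlt
  rw [not_le] at hlt
  refine expMeasure_Ioc_pos hlt (mul_pos E.lam_pos E.T_pos) ?_
  have hmp : MeasurePreserving (fun ω : ℝ × (ℕ → ℝ) => ω.2 0) E.law (expMeasure 1) :=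
    MeasurePreserving.comp ⟨measurable_pi_apply 0, map_eval_gapLaw 0⟩ measurePreserving_snd
  rw [← hmp.measure_preimage measurableSet_Ioc.nullMeasurableSet, measure_eq_zero_iff_ae_notMem]
  filter_upwards [ae_ncard_eq h, E.ae_isState] with ω h1 hω h2
  rw [M.finalClock_of_arrival_eq (M.arrival_eq_T_of_lt h2.1)] at h1
  have h3 := (hω.ncard_pos_iff _).2 h2.2
  rw [← h1, hω.ncard_pos_iff] at h3
  exact absurd h3 (not_le.2 h2.1)

/-- If no point of the Poisson process is missed, access is almost surely full on the path of the
truthful buyer: given the size and the time of the first reward, the second point falls with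
positive probability in any gap between the final clock and `λ T`. -/
lemma ae_finalClock_eq (h : E.lam * E.T ≤ ∫ ω, rewards ω (M.finalClock ω.1 (ω.2 0)) ∂E.law) :
    ∀ᵐ ω ∂E.law, M.finalClock ω.1 (ω.2 0) = E.lam * E.T := by
  have hmp := measurePreserving_size_gaps E
  have hmeas : MeasurableSet {p : (ℝ × ℝ) × ℝ |
      ¬ (M.finalClock p.1.1 p.1.2 < p.1.2 + p.2 ∧ p.1.2 + p.2 ≤ E.lam * E.T)} := by
    refine MeasurableSet.compl (MeasurableSet.inter ?_ ?_)
    · exact measurableSet_lt (M.measurable_finalClock.comp measurable_fst)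
        ((measurable_snd.comp measurable_fst).add measurable_snd)
    · exact measurableSet_le ((measurable_snd.comp measurable_fst).add measurable_snd)
        measurable_const
  have h1 : ∀ᵐ p ∂(E.F.prod (expMeasure 1)).prod (expMeasure 1),
      ¬ (M.finalClock p.1.1 p.1.2 < p.1.2 + p.2 ∧ p.1.2 + p.2 ≤ E.lam * E.T) := by
    rw [← hmp.map_eq, ae_map_iff hmp.measurable.aemeasurable hmeas]
    filter_upwards [ae_ncard_eq h, E.ae_isState] with ω h1 hω h2
    have h3 := hω.one_lt_ncard h2.2
    have h4 := hω.ncard_le_one h2.1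
    omega
  have h2 := Measure.ae_ae_of_ae_prod h1
  have h3 : ∀ᵐ ω ∂E.law, ∀ᵐ y ∂expMeasure 1,
      ¬ (M.finalClock ω.1 (ω.2 0) < ω.2 0 + y ∧ ω.2 0 + y ≤ E.lam * E.T) :=
    (Measure.quasiMeasurePreserving_fst.comp hmp.quasiMeasurePreserving).ae h2
  filter_upwards [h3, E.ae_isState] with ω h4 hω
  rcases lt_or_ge (ω.2 0) (E.lam * E.T) with hx | hx
  · refine le_antisymm (M.finalClock_le hω) ?_
    by_contra hlt
    rw [not_le] at hlt
    refine expMeasure_Ioc_pos (a := M.finalClock ω.1 (ω.2 0) - ω.2 0)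
      (b := E.lam * E.T - ω.2 0) (by linarith) (by linarith) ?_
    rw [measure_eq_zero_iff_ae_notMem]
    filter_upwards [h4] with y hy hmem
    exact hy ⟨by linarith [hmem.1], by linarith [hmem.2]⟩
  -- No reward arrives before `T`, so the final clock is the silent one.
  · rw [M.finalClock_of_arrival_eq (M.arrival_eq_T_of_le hx), silentClock_eq h]

/-! ### Payoffs in IC-IR mechanisms -/

/-- The buyer gets the surplus that the seller does not get. -/
lemma buyerPayoff_truthful_eq {π : ℝ × ℝ} (hL : M.sellerPayoff .low .low = (π.1 : EReal))
    (hH : M.sellerPayoff .high .high = (π.2 : EReal)) :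
    (M.buyerPayoff fun θ ω => M.truthful θ θ ω) =
      ((E.mu0 * ∫ ω, rewards ω (M.finalClock ω.1 (ω.2 0)) ∂E.law - weightedPayoff E π : ℝ) :
        EReal) := by
  rw [sellerPayoff_eq] at hL hH
  have hi := integrable_of_expectation_eq_coe (M.measurable_finalPrice _ _) hH
  rw [expectation_eq_integral hi, EReal.coe_eq_coe_iff] at hH
  rw [funext (M.finalPrice_low .low), expectation_const, EReal.coe_eq_coe_iff] at hL
  have hi' : Integrable (fun ω => rewards ω (M.finalClock ω.1 (ω.2 0)) -
      M.finalPrice .high .high ω) E.law := M.integrable_rewards_finalClock.sub hi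
  rw [buyerPayoff, buyerPayoffGiven_high_truthful, buyerPayoffGiven_low_truthful,
    expectation_eq_integral hi',
    integral_sub M.integrable_rewards_finalClock hi, hH, hL, weightedPayoff]
  norm_cast
  ring

lemma weightedPayoff_le_surplus (hM : M.IsICIR) {π : ℝ × ℝ}
    (hL : M.sellerPayoff .low .low = (π.1 : EReal))
    (hH : M.sellerPayoff .high .high = (π.2 : EReal)) :
    weightedPayoff E π ≤ E.mu0 * ∫ ω, rewards ω (M.finalClock ω.1 (ω.2 0)) ∂E.law := by
  have h := hM.buyer_ir
  rw [buyerPayoff_truthful_eq hL hH, EReal.coe_nonneg] at h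
  linarith

lemma weightedPayoff_le (hM : M.IsICIR) {π : ℝ × ℝ}
    (hL : M.sellerPayoff .low .low = (π.1 : EReal))
    (hH : M.sellerPayoff .high .high = (π.2 : EReal)) :
    weightedPayoff E π ≤ E.lam * E.mu0 * E.T := by
  have h1 := weightedPayoff_le_surplus hM hL hH
  have h2 := mul_le_mul_of_nonneg_left M.integral_rewards_finalClock_le E.mu0_mem.1.le
  linarith

/-- The final price of type `τ` after the report `q` is integrable if it is bounded below by
means of the integrable price after the truthful report: incentive compatibility bounds its mean above. -/
lemma integrable_finalPrice (hM : M.IsICIR) {r a b d : ℝ} (hb : 0 < b) (τ : Quality)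
    (hτ : M.sellerPayoff τ τ = (r : EReal)) {q : Quality}
    (hle : ∀ᵐ ω ∂E.law, d ≤ a * M.finalPrice τ τ ω + b * M.finalPrice τ q ω) :
    Integrable (M.finalPrice τ q) E.law := by
  have h1 := hM.seller_ic τ q
  rw [hτ, sellerPayoff_eq] at h1
  rw [sellerPayoff_eq] at hτ
  have hi := integrable_of_expectation_eq_coe (M.measurable_finalPrice _ _) hτ
  refine integrable_of_le_of_expectation_le (M.measurable_finalPrice _ _)
    (h := fun ω => (d - a * M.finalPrice τ τ ω) / b)
    (((integrable_const d).sub (hi.const_mul a)).div_const b) ?_ h1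
  filter_upwards [hle] with ω hω
  rw [div_le_iff₀ hb]
  linarith

/-- If the weighted payoff attains the bound, no type of the seller gets less than `λ μ₀ T`. The
buyer could simulate a truthful buyer who faces quality `τ`. As access is full, this yields the
full surplus, so the expected price of the simulating buyer is at least `λ μ₀ T`. But that price
averages what type `τ` gets from the two reports, which is at most its truthful payoff. -/
lemma le_sellerPayoff (hM : M.IsICIR) {π : ℝ × ℝ}
    (hL : M.sellerPayoff .low .low = (π.1 : EReal))
    (hH : M.sellerPayoff .high .high = (π.2 : EReal))
    (hπ : E.lam * E.mu0 * E.T ≤ weightedPayoff E π) (τ : Quality) :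
    ((E.lam * E.mu0 * E.T : ℝ) : EReal) ≤ M.sellerPayoff τ τ := by
  have hμ := E.mu0_mem
  have hsurplus : E.lam * E.T ≤ ∫ ω, rewards ω (M.finalClock ω.1 (ω.2 0)) ∂E.law := by
    have := hπ.trans (weightedPayoff_le_surplus hM hL hH)
    exact le_of_mul_le_mul_left (by linarith) hμ.1
  have hfull : ∀ᵐ ω ∂E.law, M.clock .high (M.response τ .high ω) E.T = E.lam * E.T := by
    cases τ with
    | low =>
      exact ae_of_all _ fun ω => (M.clock_eq_silentClock E.T_pos.le le_rfl).trans
        (silentClock_eq hsurplus)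
    | high => exact ae_finalClock_eq hsurplus
  have hdev : ∀ᵐ ω ∂E.law, E.lam * E.mu0 * E.T ≤
      E.mu0 * M.finalPrice τ .high ω + (1 - E.mu0) * M.finalPrice τ .low ω := by
    filter_upwards [hfull, E.ae_isState] with ω h1 hω
    have h2 := hM.buyer_ic (M.simulate τ ω hω)
    rw [M.buyerPayoff_simulate τ hω h1, buyerPayoff_truthful_eq hL hH,
      EReal.coe_le_coe_iff] at h2
    have h3 := mul_le_mul_of_nonneg_left M.integral_rewards_finalClock_le hμ.1.le
    linarith
  obtain ⟨r, hr⟩ : ∃ r : ℝ, M.sellerPayoff τ τ = (r : EReal) := by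
    cases τ with
    | low => exact ⟨_, hL⟩
    | high => exact ⟨_, hH⟩
  have hint : ∀ q, Integrable (M.finalPrice τ q) E.law := by
    have hτ : Integrable (M.finalPrice τ τ) E.law :=
      integrable_of_expectation_eq_coe (M.measurable_finalPrice _ _)
        ((M.sellerPayoff_eq τ τ).symm.trans hr)
    intro q
    cases τ <;> cases q
    · exact hτ
    · exact integrable_finalPrice hM hμ.1 .low hr
        (hdev.mono fun ω hω => hω.trans (add_comm _ _).le)
    · exact integrable_finalPrice hM (sub_pos.2 hμ.2) .high hr hdev
    · exact hτ
  have hle : ∀ q, ∫ ω, M.finalPrice τ q ω ∂E.law ≤ r := by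
    intro q
    have := hM.seller_ic τ q
    rwa [hr, sellerPayoff_eq, expectation_eq_integral (hint q), EReal.coe_le_coe_iff] at this
  have hmean := integral_mono_ae (integrable_const _)
    (((hint .high).const_mul E.mu0).add ((hint .low).const_mul (1 - E.mu0))) hdev
  have hsum : ∫ ω, (E.mu0 * M.finalPrice τ .high ω + (1 - E.mu0) * M.finalPrice τ .low ω) ∂E.law =
      E.mu0 * ∫ ω, M.finalPrice τ .high ω ∂E.law +
        (1 - E.mu0) * ∫ ω, M.finalPrice τ .low ω ∂E.law := by
    rw [integral_add ((hint .high).const_mul _) ((hint .low).const_mul _), integral_const_mul,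
      integral_const_mul]
  simp only [integral_const, probReal_univ, one_smul] at hmean
  rw [hr, EReal.coe_le_coe_iff]
  have h1 := mul_le_mul_of_nonneg_left (hle .high) hμ.1.le
  have h2 := mul_le_mul_of_nonneg_left (hle .low) (sub_pos.2 hμ.2).le
  have h3 := hmean.trans hsum.le
  linarith

end Mechanism

lemma mem_payoffSet_sellExAnte (E : Env) :
    (E.lam * E.mu0 * E.T, E.lam * E.mu0 * E.T) ∈ payoffSet E :=
  ⟨sellExAnte E, isICIR_sellExAnte E, sellerPayoff_sellExAnte E _ _,
    sellerPayoff_sellExAnte E _ _⟩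

lemma weightedPayoff_diag (E : Env) (a : ℝ) : weightedPayoff E (a, a) = a := by
  simp only [weightedPayoff]; ring

lemma weightedPayoff_le_of_mem {E : Env} {π : ℝ × ℝ} (h : π ∈ payoffSet E) :
    weightedPayoff E π ≤ E.lam * E.mu0 * E.T := by
  obtain ⟨M, hM, hL, hH⟩ := h
  exact Mechanism.weightedPayoff_le hM hL hH

lemma eq_of_le_weightedPayoff {E : Env} {π : ℝ × ℝ} (h : π ∈ payoffSet E)
    (hle : E.lam * E.mu0 * E.T ≤ weightedPayoff E π) :
    π = (E.lam * E.mu0 * E.T, E.lam * E.mu0 * E.T) := by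
  have hup := weightedPayoff_le_of_mem h
  obtain ⟨M, hM, hL, hH⟩ := h
  have h1 := Mechanism.le_sellerPayoff hM hL hH hle .low
  have h2 := Mechanism.le_sellerPayoff hM hL hH hle .high
  rw [hL, EReal.coe_le_coe_iff] at h1
  rw [hH, EReal.coe_le_coe_iff] at h2
  have hμ := E.mu0_mem
  rw [weightedPayoff] at hup
  have h3 := mul_le_mul_of_nonneg_left h1 (sub_pos.2 hμ.2).le
  have h4 := mul_le_mul_of_nonneg_left h2 hμ.1.le
  ext
  · exact le_antisymm (le_of_mul_le_mul_left (by linarith) (sub_pos.2 hμ.2)) h1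
  · exact le_antisymm (le_of_mul_le_mul_left (by linarith) hμ.1) h2

end InformedSeller

end
theorem mainTheorem7 (E : InformedSeller.Env) :
    -- selling ex ante is an IC-IR mechanism, with payoffs `(λ μ₀ T, λ μ₀ T)`
    ((InformedSeller.sellExAnte E).IsICIR ∧
      ∀ θ, (InformedSeller.sellExAnte E).sellerPayoff θ θ =
        ((E.lam * E.mu0 * E.T : ℝ) : EReal)) ∧
    -- these payoffs are the unique maximizer of the weighted payoff over the IC-IR payoff set
    {π | π ∈ InformedSeller.payoffSet E ∧
        IsMaxOn (InformedSeller.weightedPayoff E) (InformedSeller.payoffSet E) π} =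
      {(E.lam * E.mu0 * E.T, E.lam * E.mu0 * E.T)} ∧
    -- the maximum value is `λ μ₀ T`
    IsGreatest (InformedSeller.weightedPayoff E '' InformedSeller.payoffSet E)
      (E.lam * E.mu0 * E.T) := by
  have hmem := InformedSeller.mem_payoffSet_sellExAnte E
  have hval := InformedSeller.weightedPayoff_diag E (E.lam * E.mu0 * E.T)
  refine ⟨⟨InformedSeller.isICIR_sellExAnte E,
    fun θ => InformedSeller.sellerPayoff_sellExAnte E θ θ⟩, ?_, ⟨_, hmem, hval⟩, ?_⟩
  · refine Subset.antisymm ?_ ?_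
    · rintro π ⟨hπ, hmax⟩
      exact InformedSeller.eq_of_le_weightedPayoff hπ (hval.symm.le.trans (hmax hmem))
    · rintro _ rfl
      exact ⟨hmem, fun π hπ => (InformedSeller.weightedPayoff_le_of_mem hπ).trans hval.symm.le⟩
  · rintro _ ⟨π, hπ, rfl⟩
    exact InformedSeller.weightedPayoff_le_of_mem hπ
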